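/- Let $\mathcal G=(\mathcal V,\mathcal E)$ be a finite directed multigraph (cycles allowed) with edge capacities $C(e)$, a source $S\in\mathcal V$ and a nonempty set $D\subseteq\mathcal V$ of receivers. Let $\mathcal P$ be the set of nonempty subsets of $D$ and $\mathcal Q$ the set of collections of two or more pairwise disjoint members of $\mathcal P$; for $Q\in\mathcal Q$ write $\bigcup Q\in\mathcal P$ for the union of its members. Let $h$, $x_e(P)$, $r^v(Q)$, $n^v(Q)$ ($e\in\mathcal E$, $v\in\mathcal V$, $P\in\mathcal P$, $Q\in\mathcal Q$) be nonnegative rational numbers. Put $x^v_{in}(P)=\sum_{e\text{ into }v}x_e(P)$, $x^v_{out}(P)=\sum_{e\text{ out of }v}x_e(P)$ and $I_k(x)=\sum_{P\ni k}x(P)$. Suppose that the following hold. * Edge constraints: $\sum_P x_e(P)\le C(e)$ for all $e$. * Flow constraints: $I_k(x^v_{in})=I_k(x^v_{out})$ for all $k\in D$ and $v\in\mathcal V\setminus\{S,k\}$, and $I_k(x^S_{out})=I_k(x^k_{in})=h$ for all $k\in D$. * Node constraints: for all $v\in\mathcal V$ and $P\in\mathcal P$, $$x^v_{out}(P)+d^v(P)=x^v_{in}(P)+s^v(P)+\sum_{Q:\,P\in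 Q}\bigl(r^v(Q)-n^v(Q)\bigr)-\sum_{Q:\,\bigcup Q=P}\bigl(r^v(Q)-n^v(Q)\bigr).$$ Here $s^v(P)=h$ if $v=S$ and $P=D$, and $s^v(P)=0$ otherwise (the source produces $h$ packets per unit time, meant for all receivers); $d^v(P)=h$ if $v\in D$ and $P=\{v\}$, and $d^v(P)=0$ otherwise (the receiver $v$ hands over $h$ packets per unit time meant for it alone). Then there is an integer $T\ge 1$ such that $Th$ and all $Tx_e(P)$, $Tr^v(Q)$, $Tn^v(Q)$ are integers. For every such $T$ and every sufficiently large finite field $F$, there is a valid linear multicast code over $F$ of the following form, where one unit of time is a block of $T$ time instances. In each block: * the source emits $Th$ symbols, and edge $e$ carries $Tx_e(P)$ symbols labelled $P$ for each $P\in\mathcal P$ (hence at most $T\,C(e)$ in all); * node $v$ performs, for each $Q\in\mathcal Q$, exactly $Tr^v(Q)$ replications, each of which copies one symbol labelled $\bigcup Q$ into one symbol labelled $P$ for each $P\in Q$, and exactly $Tn^v(Q)$ network coding operations, each of which combines one symbol labelled $P$ for each $P\in Q$ linearly, with nonzero fixed coefficients, into one symbol labelled $\bigcup Q$; * apart from these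 operations every node only forwards: the symbols that are available at $v$ (source symbols, which are labelled $D$, arriving symbols, and outputs of its operations) are matched one to one, within $v$ and with equal labels, to their uses at $v$ (symbols sent on outgoing edges, inputs of its operations and, if $v\in D$, the $Th$ symbols labelled $\{v\}$ handed over to the receiver $v$). Crossing an edge and each replication or coding operation take one unit of time, and initially all symbols are $0$. Valid means that the edge capacities are respected and that every receiver $k$ can decode: for some fixed delay $\delta$, the symbols handed over to $k$ up to time $t+\delta$ determine all $Th$ source symbols of time $t$, for every $t$. -/

import Mathlib

/-- A multicast problem on a finite directed (multi)graph with node set `V` and edge set `E`: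
edge capacities, one source and a nonempty set `D` of receivers.  Cycles are allowed. -/
structure MulticastNetwork (V E : Type*) where
  /-- tail of an edge -/
  src : E → V
  /-- head of an edge -/
  tgt : E → V
  /-- edge capacities -/
  cap : E → ℝ
  /-- the source node -/
  source : V
  /-- the set `D` of receivers -/
  D : Finset V
  D_nonempty : D.Nonempty

/-- `𝒫`: the nonempty subsets of the receiver set `D`. -/
abbrev RecvSet {V : Type*} [DecidableEq V] (D : Finset V) : Type _ :=
  {P : Finset V // P.Nonempty ∧ P ⊆ D}

/-- `𝒬`: the collections of two or more pairwise disjoint members of `𝒫`. -/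
abbrev RecvColl {V : Type*} [DecidableEq V] (D : Finset V) : Type _ :=
  {Q : Finset (RecvSet D) // 2 ≤ Q.card ∧ ∀ A ∈ Q, ∀ B ∈ Q, A ≠ B → Disjoint A.1 B.1}

noncomputable instance RecvColl.instFintype {V : Type*} [Fintype V] [DecidableEq V]
    (D : Finset V) : Fintype (RecvColl D) :=
  Fintype.ofFinite _

/-- The union of the members of a collection `Q ∈ 𝒬`, again an element of `𝒫`. -/
def RecvColl.union {V : Type*} [DecidableEq V] {D : Finset V} (Q : RecvColl D) : RecvSet D :=
  ⟨Q.1.biUnion (fun A => A.1), by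
    constructor
    · obtain ⟨A, hA⟩ := Finset.card_pos.mp (lt_of_lt_of_le Nat.zero_lt_two Q.2.1)
      obtain ⟨x, hx⟩ := A.2.1
      exact ⟨x, Finset.mem_biUnion.mpr ⟨A, hA, hx⟩⟩
    · exact Finset.biUnion_subset.mpr (fun A _ => A.2.2)⟩

namespace MulticastNetwork

variable {V E : Type*} [Fintype V] [DecidableEq V] [Fintype E]

/-- The label `D` itself: meant for all receivers. -/
def allRecv (G : MulticastNetwork V E) : RecvSet G.D :=
  ⟨G.D, G.D_nonempty, Finset.Subset.refl _⟩

/-- The label `{k}` for a receiver `k`. -/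
def oneRecv (G : MulticastNetwork V E) (k : G.D) : RecvSet G.D :=
  ⟨{k.1}, Finset.singleton_nonempty _, Finset.singleton_subset_iff.mpr k.2⟩

/-- `x_in^v(P)`: information flow on the edges entering `v`. -/
def inFlow (G : MulticastNetwork V E) (X : E → RecvSet G.D → ℚ) (v : V) (P : RecvSet G.D) : ℚ :=
  ∑ e : E with G.tgt e = v, X e P

/-- `x_out^v(P)`: information flow on the edges leaving `v`. -/
def outFlow (G : MulticastNetwork V E) (X : E → RecvSet G.D → ℚ) (v : V) (P : RecvSet G.D) : ℚ :=
  ∑ e : E with G.src e = v, X e P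

/-- `I_k(x) = ∑_{P ∋ k} x(P)`: the flow to receiver `k` inside an information flow vector. -/
def flowTo (G : MulticastNetwork V E) (k : G.D) (x : RecvSet G.D → ℚ) : ℚ :=
  ∑ P : RecvSet G.D with k.1 ∈ P.1, x P

/-- Edge constraints. -/
def EdgeConstraints (G : MulticastNetwork V E) (X : E → RecvSet G.D → ℚ) : Prop :=
  ∀ e, ((∑ P, X e P : ℚ) : ℝ) ≤ G.cap e

/-- Flow constraints for rate `h`. -/
def FlowConstraints (G : MulticastNetwork V E) (X : E → RecvSet G.D → ℚ) (h : ℚ) : Prop :=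
  (∀ (k : G.D) (v : V), v ≠ G.source → v ≠ k.1 →
      G.flowTo k (G.inFlow X v) = G.flowTo k (G.outFlow X v)) ∧
  ∀ k : G.D, G.flowTo k (G.outFlow X G.source) = h ∧ G.flowTo k (G.inFlow X k.1) = h

/-- Information entering the network at `v` from outside: the source produces `h` packets per
unit time, each meant for all receivers. -/
def injected (G : MulticastNetwork V E) (h : ℚ) (v : V) (P : RecvSet G.D) : ℚ :=
  if v = G.source ∧ P = G.allRecv then h else 0

/-- Information leaving the network at `v`: a receiver `v` hands over `h` packets per unit time
that are meant for `v` only. -/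
def delivered (G : MulticastNetwork V E) (h : ℚ) (v : V) (P : RecvSet G.D) : ℚ :=
  if v ∈ G.D ∧ P.1 = {v} then h else 0

/-- Node constraints at every node, with routing (replication) variables `R v` and network coding
variables `N v`.  Data produced at the source counts as input of the source, and data handed
over at a receiver counts as output of that receiver. -/
def NodeConstraints (G : MulticastNetwork V E) (X : E → RecvSet G.D → ℚ)
    (R N : V → RecvColl G.D → ℚ) (h : ℚ) : Prop :=
  ∀ (v : V) (P : RecvSet G.D),
    G.outFlow X v P + G.delivered h v P =
      G.inFlow X v P + G.injected h v P
        + (∑ Q : RecvColl G.D with P ∈ Q.1, (R v Q - N v Q))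
        - ∑ Q : RecvColl G.D with Q.union = P, (R v Q - N v Q)

/-- Numbers of packets and of operations of a multicast code, per block of time. -/
structure Counts (G : MulticastNetwork V E) where
  /-- number of source packets -/
  rate : ℕ
  /-- number of packets that edge `e` carries for the receiver set `P` -/
  load : E → RecvSet G.D → ℕ
  /-- number of replications of type `Q` performed at node `v` -/
  rep : V → RecvColl G.D → ℕ
  /-- number of network coding operations of type `Q` performed at node `v` -/
  cod : V → RecvColl G.D → ℕ

/-- The packets that become available at some node. -/
inductive Supply (G : MulticastNetwork V E) (c : G.Counts) : Type _
  /-- the `i`-th source packet, available at the source -/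
  | inject (i : Fin c.rate)
  /-- a packet that arrives over edge `e` -/
  | arrive (e : E) (P : RecvSet G.D) (i : Fin (c.load e P))
  /-- the copy, meant for `P ∈ Q`, made by the `i`-th replication of type `Q` at `v` -/
  | copy (v : V) (Q : RecvColl G.D) (i : Fin (c.rep v Q)) (P : RecvSet G.D) (hP : P ∈ Q.1)
  /-- the result of the `i`-th network coding operation of type `Q` at `v` -/
  | coded (v : V) (Q : RecvColl G.D) (i : Fin (c.cod v Q))

/-- The places where a packet is used at some node. -/
inductive Demand (G : MulticastNetwork V E) (c : G.Counts) : Type _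
  /-- the `i`-th packet handed over to receiver `k` -/
  | deliver (k : G.D) (i : Fin c.rate)
  /-- a packet sent over edge `e` -/
  | send (e : E) (P : RecvSet G.D) (i : Fin (c.load e P))
  /-- the packet replicated by the `i`-th replication of type `Q` at `v` -/
  | replicate (v : V) (Q : RecvColl G.D) (i : Fin (c.rep v Q))
  /-- the packet for `P ∈ Q` that enters the `i`-th network coding operation of type `Q` at `v` -/
  | merge (v : V) (Q : RecvColl G.D) (i : Fin (c.cod v Q)) (P : RecvSet G.D) (hP : P ∈ Q.1)

/-- The node at which a packet is available. -/
def Supply.node {G : MulticastNetwork V E} {c : G.Counts} : G.Supply c → V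
  | .inject _ => G.source
  | .arrive e _ _ => G.tgt e
  | .copy v _ _ _ _ => v
  | .coded v _ _ => v

/-- The set of receivers that an available packet is meant for. -/
def Supply.label {G : MulticastNetwork V E} {c : G.Counts} : G.Supply c → RecvSet G.D
  | .inject _ => G.allRecv
  | .arrive _ P _ => P
  | .copy _ _ _ P _ => P
  | .coded _ Q _ => Q.union

/-- The node at which a packet is used. -/
def Demand.node {G : MulticastNetwork V E} {c : G.Counts} : G.Demand c → V
  | .deliver k _ => k.1
  | .send e _ _ => G.src e
  | .replicate v _ _ => v
  | .merge v _ _ _ _ => v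

/-- The set of receivers that a used packet is meant for. -/
def Demand.label {G : MulticastNetwork V E} {c : G.Counts} : G.Demand c → RecvSet G.D
  | .deliver k _ => G.oneRecv k
  | .send _ P _ => P
  | .replicate _ Q _ => Q.union
  | .merge _ _ _ P _ => P

/-- A linear multicast code over the field `F` in which nodes only route, replicate and
network code.  `wire` matches each use of a packet with a packet that is available at the same
node and meant for the same receivers, one to one.  A network coding operation
outputs a linear combination of its inputs, with nonzero coefficients. -/
structure Code (G : MulticastNetwork V E) (F : Type*) [Field F] extends Counts G where
  wire : G.Demand toCounts ≃ G.Supply toCounts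
  node_wire : ∀ d, (wire d).node = d.node
  label_wire : ∀ d, (wire d).label = d.label
  coef : (v : V) → (Q : RecvColl G.D) → Fin (cod v Q) → RecvSet G.D → F
  coef_ne_zero : ∀ v Q i, ∀ P ∈ Q.1, coef v Q i P ≠ 0

/-- The symbol in each available packet at each time, when the source packets are the streams
`w i 0, w i 1, …`.  Crossing an edge and each replication or network coding
operation take one unit of time, and nothing but the source emits a nonzero symbol at time `0`. -/
def Code.signal {G : MulticastNetwork V E} {F : Type*} [Field F] (c : G.Code F)
    (w : Fin c.rate → ℕ → F) : ℕ → G.Supply c.toCounts → F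
  | t, .inject i => w i t
  | 0, .arrive _ _ _ => 0
  | 0, .copy _ _ _ _ _ => 0
  | 0, .coded _ _ _ => 0
  | t + 1, .arrive e P i => c.signal w t (c.wire (.send e P i))
  | t + 1, .copy v Q i _ _ => c.signal w t (c.wire (.replicate v Q i))
  | t + 1, .coded v Q i =>
      ∑ P : {P // P ∈ Q.1}, c.coef v Q i P.1 * c.signal w t (c.wire (.merge v Q i P.1 P.2))

/-- The symbols handed over to receiver `k`. -/
def Code.output {G : MulticastNetwork V E} {F : Type*} [Field F] (c : G.Code F)
    (w : Fin c.rate → ℕ → F) (k : G.D) (i : Fin c.rate) (t : ℕ) : F :=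
  c.signal w t (c.wire (.deliver k i))

/-- Receiver `k` can decode: with a fixed delay `δ`, what it has been handed up to time `t + δ`
determines all source symbols of time `t`. -/
def Code.CanDecode {G : MulticastNetwork V E} {F : Type*} [Field F] (c : G.Code F)
    (k : G.D) : Prop :=
  ∃ δ : ℕ, ∃ dec : (t : ℕ) → (Fin c.rate → Fin (t + δ + 1) → F) → Fin c.rate → F,
    ∀ (w : Fin c.rate → ℕ → F) (t : ℕ) (i : Fin c.rate),
      dec t (fun j s => c.output w k j s) i = w i t

/-- The code, run once per block of `T` time instances, is a valid multicast code: it respects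
the edge capacities and every receiver can decode the data. -/
def Code.Valid {G : MulticastNetwork V E} {F : Type*} [Field F] (c : G.Code F) (T : ℕ) : Prop :=
  (∀ e, ((∑ P, c.load e P : ℕ) : ℝ) ≤ T * G.cap e) ∧ ∀ k, c.CanDecode k

/-- Per block of `T` time instances the code multicasts `T h` packets, sends the information flow
`T X` over the edges, and performs exactly the operations `T R` and `T N` at the nodes. -/
def Code.Performs {G : MulticastNetwork V E} {F : Type*} [Field F] (c : G.Code F) (T : ℕ)
    (X : E → RecvSet G.D → ℚ) (R N : V → RecvColl G.D → ℚ) (h : ℚ) : Prop :=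
  (c.rate : ℚ) = T * h ∧ (∀ e P, (c.load e P : ℚ) = T * X e P) ∧
    (∀ v Q, (c.rep v Q : ℚ) = T * R v Q) ∧ ∀ v Q, (c.cod v Q : ℚ) = T * N v Q

/-- All data become integers over `T` time instances. -/
def IntegralOver (G : MulticastNetwork V E) (T : ℕ)
    (X : E → RecvSet G.D → ℚ) (R N : V → RecvColl G.D → ℚ) (h : ℚ) : Prop :=
  (∃ m : ℤ, (m : ℚ) = T * h) ∧ (∀ e P, ∃ m : ℤ, (m : ℚ) = T * X e P) ∧
    (∀ v Q, ∃ m : ℤ, (m : ℚ) = T * R v Q) ∧ ∀ v Q, ∃ m : ℤ, (m : ℚ) = T * N v Q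

end MulticastNetwork

open Matrix Function

/-! Scaled by `T`, the node constraints say that at each node and for each label as many packets
become available as are used, so a one-to-one wiring exists (`exists_wiring`). It remains to choose
coefficients.

Fix a receiver `k` and let each coding operation forward only its input meant for `k`. Each
available packet whose label contains `k` then repeats a packet of the previous time unit whose
label also contains `k`. Disjointness of the members of `Q` makes this backward map injective on
such packets. Sending each source packet to the corresponding delivery at `k` closes the paths into
cycles: on a finite set an injective map is a permutation. Hence the path traced back from each
delivery ends at a source packet, and distinct deliveries reach distinct ones, even if the network
has cycles (`exists_first_return`). The transfer matrix from source to `k` is then a permutation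
matrix with rows scaled by powers of `X`, of determinant `± X ^ n`.

For indeterminate coefficients, some coefficient of this determinant is thus an integer polynomial
with value `± 1` at a 0/1 point, so it is nonzero modulo every prime. Over a large finite field one
choice of nonzero coefficients serves all receivers (`exists_coef`). A nonzero determinant over
power series allows inversion up to a delay (`Code.canDecode_of_det_ne_zero`). -/

theorem exists_pos_forall_int_eq_mul {ι : Type*} [Finite ι] (f : ι → ℚ) :
    ∃ T : ℕ, 0 < T ∧ ∀ i, ∃ m : ℤ, (m : ℚ) = T * f i := by
  have := Fintype.ofFinite ι
  refine ⟨∏ i, (f i).den, Finset.prod_pos fun i _ => (f i).den_pos, fun i => ?_⟩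
  obtain ⟨c, hc⟩ := Finset.dvd_prod_of_mem (fun i => (f i).den) (Finset.mem_univ i)
  refine ⟨(f i).num * c, ?_⟩
  have h := Rat.mul_den_eq_num (f i)
  rw [hc]
  push_cast
  rw [← h]
  ring

/-! ### Nonvanishing over finite fields and matrices over power series. -/

/-- A polynomial over `ℤ` that stays nonzero modulo the characteristic has a nonzero value over
every sufficiently large finite field. -/
theorem MvPolynomial.exists_aeval_ne_zero {σ F : Type*} [Finite σ] [Field F] [Finite F]
    (p : MvPolynomial σ ℤ) (hp : MvPolynomial.map (Int.castRingHom F) p ≠ 0)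
    (hcard : p.totalDegree < Nat.card F) : ∃ x : σ → F, MvPolynomial.aeval x p ≠ 0 := by
  have := Fintype.ofFinite F
  by_contra! hzero
  refine hp (eq_zero_of_eval_zero_at_prod_finset _ (fun _ => Finset.univ) (fun i => ?_)
    fun x _ => ?_)
  · rw [Finset.card_univ, ← Nat.card_eq_fintype_card]
    refine ((degreeOf_le_totalDegree _ i).trans ?_).trans_lt hcard
    exact Finset.sup_mono (support_map_subset _ _)
  · rw [← hzero x, eval_map, aeval_def, algebraMap_int_eq]

/-- Over a field, a square matrix of power series with nonzero determinant is invertible up to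
a shift. -/
theorem Matrix.exists_mul_eq_X_pow_smul_one {I F : Type*} [Fintype I] [DecidableEq I] [Field F]
    (M : Matrix I I (PowerSeries F)) (hM : M.det ≠ 0) :
    ∃ (δ : ℕ) (L : Matrix I I (PowerSeries F)), L * M = (PowerSeries.X ^ δ : PowerSeries F) • 1 := by
  obtain ⟨u, hu⟩ := PowerSeries.isUnit_divided_by_X_pow_order hM
  -- The determinant is `X ^ δ` times a unit, with `δ` its order; the adjugate divided by that unit
  -- is the inverse up to the shift.
  refine ⟨M.det.order.toNat, (↑u⁻¹ : PowerSeries F) • M.adjugate, ?_⟩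
  rw [smul_mul, adjugate_mul, smul_smul]
  congr 1
  nth_rw 1 [← PowerSeries.X_pow_order_mul_divXPowOrder (f := M.det)]
  rw [← hu, mul_comm, mul_assoc, Units.mul_inv, mul_one]

/-! ### First returns of an injective map on a finite invariant set. -/

section FirstReturn

variable {S I A : Type*} [Fintype S] [CommRing A]

open Classical in
/-- The matrix that moves every state outside `range inj` along `f` and stops on `range inj`. -/
noncomputable def stoppedMatrix (A : Type*) [CommRing A] (f : S → S) (inj : I → S) : Matrix S S A :=
  fun s s' => if s ∉ Set.range inj ∧ s' = f s then 1 else 0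

open Classical in
theorem stoppedMatrix_pow_succ_apply [DecidableEq S] (f : S → S) (inj : I → S) (n : ℕ) (s s' : S) :
    (stoppedMatrix A f inj ^ (n + 1)) s s' =
      if s ∉ Set.range inj then (stoppedMatrix A f inj ^ n) (f s) s' else 0 := by
  rw [pow_succ', mul_apply]
  by_cases hs : s ∈ Set.range inj <;> simp [stoppedMatrix, hs]

/-- Rows of `range inj` vanish, so a walk dies after its first visit there and contributes to one
power only. -/
theorem stoppedMatrix_pow_apply [DecidableEq S] [DecidableEq I] (f : S → S) {inj : I → S} (hinj : Injective inj)
    (n : ℕ) (s : S) (i : I) (hlt : ∀ m < n, f^[m] s ∉ Set.range inj) (hn : f^[n] s = inj i)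
    (t : ℕ) (j : I) :
    (stoppedMatrix A f inj ^ t) s (inj j) = if t = n ∧ j = i then 1 else 0 := by
  induction n generalizing s t with
  | zero =>
    obtain rfl : s = inj i := hn
    cases t with
    | zero => simp [one_apply, hinj.eq_iff, eq_comm]
    | succ t => simp [stoppedMatrix_pow_succ_apply]
  | succ n ih =>
    have hs : s ∉ Set.range inj := hlt 0 n.succ_pos
    cases t with
    | zero =>
      have : s ≠ inj j := fun h => hs ⟨j, h.symm⟩
      simp [one_apply, this]
    | succ t =>
      rw [stoppedMatrix_pow_succ_apply, if_pos hs, ih (f s) (fun m hm => hlt (m + 1) (by omega)) hn]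
      simp

/-- First return times and first return positions for a map that is injective on an invariant
set. -/
theorem exists_first_return {f : S → S} {inj : I → S} (hinj : Injective inj) {U : Set S}
    (hU : Set.MapsTo f U U) (hf : Set.InjOn f U) (hI : ∀ i, inj i ∈ U) [Finite I] :
    ∃ (len : I → ℕ) (σ : Equiv.Perm I), ∀ i,
      (∀ m < len i, f^[m] (f (inj i)) ∉ Set.range inj) ∧
        f^[len i] (f (inj i)) = inj (σ i) := by
  classical
  have hU' : ∀ n, Set.MapsTo f^[n] U U := fun n => hU.iterate n
  have hf' : ∀ n, Set.InjOn f^[n] U := fun n => hf.iterate hU n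
  have hret : ∀ i, ∃ n, f^[n] (f (inj i)) ∈ Set.range inj := by
    intro i
    have hg : Injective (hU.restrict f U U) := (hU.restrict_inj).2 hf
    obtain ⟨n, hn, hper⟩ := hg.mem_periodicPts ⟨inj i, hI i⟩
    -- The count starts at `f (inj i)`, one step into the cycle of period `n`.
    refine ⟨n - 1, i, ?_⟩
    have := congrArg Subtype.val hper
    rw [hU.iterate_restrict] at this
    rw [← iterate_succ_apply, Nat.succ_eq_add_one, Nat.sub_add_cancel hn]
    exact this.symm
  choose σ hσ using fun i => Nat.find_spec (hret i)
  have hmin : ∀ i, ∀ m < Nat.find (hret i), f^[m] (f (inj i)) ∉ Set.range inj :=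
    fun i m hm => Nat.find_min (hret i) hm
  -- If two walks end at the same point, cancelling the shorter gives `inj i = f^[d] (inj i')`. For
  -- `d > 0` the walk from `i'` would have met `range inj` before its first return.
  have key : ∀ i i', σ i = σ i' → Nat.find (hret i) ≤ Nat.find (hret i') → i = i' := by
    intro i i' h hle
    obtain ⟨d, hd⟩ := Nat.exists_eq_add_of_le hle
    have h1 : f^[Nat.find (hret i) + 1] (inj i) =
        f^[Nat.find (hret i) + 1] (f^[d] (inj i')) := by
      rw [← iterate_add_apply, iterate_succ_apply, ← hσ, h, hσ, ← iterate_succ_apply, hd]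
      congr 2
      omega
    have h2 := hf' _ (hI i) (hU' d (hI i')) h1
    cases d with
    | zero => exact hinj h2
    | succ d => exact absurd ⟨i, by rw [h2, iterate_succ_apply]⟩ (hmin i' d (by omega))
  have hσinj : Injective σ := by
    intro i i' h
    rcases le_total (Nat.find (hret i)) (Nat.find (hret i')) with hle | hle
    · exact key i i' h hle
    · exact (key i' i h.symm hle).symm
  exact ⟨fun i => Nat.find (hret i), Equiv.ofBijective σ (Finite.injective_iff_bijective.1 hσinj),
    fun i => ⟨hmin i, (hσ i).symm⟩⟩

end FirstReturn

/-! ### Transfer matrices as generating functions of walks. -/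

/-- The power series matrix whose coefficient of `X ^ t` collects the entries of `B ^ t` from the
inputs `inj` to the outputs `out`. -/
noncomputable def transferMatrix {S I A : Type*} [Fintype S] [DecidableEq S] [CommRing A]
    (B : Matrix S S A) (inj out : I → S) : Matrix I I (PowerSeries A) :=
  fun i j => PowerSeries.mk fun t => (B ^ t) (out i) (inj j)

theorem transferMatrix_map {S I A A' : Type*} [Fintype S] [DecidableEq S] [CommRing A]
    [CommRing A'] (φ : A →+* A') (B : Matrix S S A) (inj out : I → S) :
    (transferMatrix B inj out).map (PowerSeries.map φ) =
      transferMatrix (B.map φ) inj out := by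
  ext i j t
  have : (B.map φ) ^ t = (B ^ t).map φ := (map_pow φ.mapMatrix B t).symm
  simp [transferMatrix, this]

theorem exists_coeff_det_transferMatrix_isUnit {S I : Type*} [Fintype S] [DecidableEq S]
    [Fintype I] [DecidableEq I] {f : S → S} {inj : I → S} (hinj : Injective inj) {U : Set S}
    (hU : Set.MapsTo f U U) (hf : Set.InjOn f U) (hI : ∀ i, inj i ∈ U) :
    ∃ n, IsUnit (PowerSeries.coeff n
      (transferMatrix (stoppedMatrix ℤ f inj) inj (fun i => f (inj i))).det) := by
  obtain ⟨len, σ, h⟩ := exists_first_return hinj hU hf hI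
  have hM : transferMatrix (stoppedMatrix ℤ f inj) inj (fun i => f (inj i)) =
      diagonal (fun i => (PowerSeries.X : PowerSeries ℤ) ^ len i) *
        (σ.permMatrix (PowerSeries ℤ)) := by
    ext i j t
    rw [diagonal_mul, transferMatrix, PowerSeries.coeff_mk,
      stoppedMatrix_pow_apply f hinj (len i) _ (σ i) (h i).1 (h i).2]
    by_cases hj : j = σ i
    · subst hj
      simp [Equiv.toPEquiv_apply, PowerSeries.coeff_X_pow]
    · have : ¬ σ i = j := fun h => hj h.symm
      simp [Equiv.toPEquiv_apply, hj, this]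
  refine ⟨∑ i, len i, ?_⟩
  rw [hM, det_mul, det_diagonal, det_permutation, Finset.prod_pow_eq_pow_sum]
  rcases Int.units_eq_one_or (Equiv.Perm.sign σ) with hs | hs <;>
    simp [hs, PowerSeries.coeff_X_pow]

namespace MulticastNetwork

variable {V E : Type*} [Fintype V] [DecidableEq V] [Fintype E]

/-! ### Wiring from the node constraints, by counting packets. -/

section Wiring

variable {G : MulticastNetwork V E} {c : G.Counts}

def supplyEquiv (G : MulticastNetwork V E) (c : G.Counts) :
    G.Supply c ≃ (Fin c.rate ⊕ (Σ (e : E) (P : RecvSet G.D), Fin (c.load e P))) ⊕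
      ((Σ (v : V) (Q : RecvColl G.D), Fin (c.rep v Q) × {P // P ∈ Q.1}) ⊕
        (Σ (v : V) (Q : RecvColl G.D), Fin (c.cod v Q))) where
  toFun
    | .inject i => .inl (.inl i)
    | .arrive e P i => .inl (.inr ⟨e, P, i⟩)
    | .copy v Q i P hP => .inr (.inl ⟨v, Q, i, P, hP⟩)
    | .coded v Q i => .inr (.inr ⟨v, Q, i⟩)
  invFun
    | .inl (.inl i) => .inject i
    | .inl (.inr ⟨e, P, i⟩) => .arrive e P i
    | .inr (.inl ⟨v, Q, i, P, hP⟩) => .copy v Q i P hP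
    | .inr (.inr ⟨v, Q, i⟩) => .coded v Q i
  left_inv s := by cases s <;> rfl
  right_inv s := by rcases s with (_ | _) | (_ | _) <;> rfl

def demandEquiv (G : MulticastNetwork V E) (c : G.Counts) :
    G.Demand c ≃ ((G.D × Fin c.rate) ⊕ (Σ (e : E) (P : RecvSet G.D), Fin (c.load e P))) ⊕
      ((Σ (v : V) (Q : RecvColl G.D), Fin (c.rep v Q)) ⊕
        (Σ (v : V) (Q : RecvColl G.D), Fin (c.cod v Q) × {P // P ∈ Q.1})) where
  toFun
    | .deliver k i => .inl (.inl (k, i))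
    | .send e P i => .inl (.inr ⟨e, P, i⟩)
    | .replicate v Q i => .inr (.inl ⟨v, Q, i⟩)
    | .merge v Q i P hP => .inr (.inr ⟨v, Q, i, P, hP⟩)
  invFun
    | .inl (.inl (k, i)) => .deliver k i
    | .inl (.inr ⟨e, P, i⟩) => .send e P i
    | .inr (.inl ⟨v, Q, i⟩) => .replicate v Q i
    | .inr (.inr ⟨v, Q, i, P, hP⟩) => .merge v Q i P hP
  left_inv s := by cases s <;> rfl
  right_inv s := by rcases s with (_ | _) | (_ | _) <;> rfl

noncomputable instance : Fintype (G.Supply c) := Fintype.ofEquiv _ (supplyEquiv G c).symm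

noncomputable instance : Fintype (G.Demand c) := Fintype.ofEquiv _ (demandEquiv G c).symm

theorem sum_supply (g : V → RecvSet G.D → ℚ) :
    ∑ s : G.Supply c, g s.node s.label =
      (c.rate * g G.source G.allRecv + ∑ e, ∑ P, c.load e P * g (G.tgt e) P) +
        ((∑ v, ∑ Q : RecvColl G.D, c.rep v Q * ∑ P ∈ Q.1, g v P) +
          ∑ v, ∑ Q : RecvColl G.D, c.cod v Q * g v Q.union) := by
  have hcoe : ∀ v (Q : RecvColl G.D), ∑ P ∈ Q.1, g v P = ∑ P : {P // P ∈ Q.1}, g v P.1 :=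
    fun v Q => (Finset.sum_coe_sort Q.1 (g v)).symm
  rw [← (supplyEquiv G c).symm.sum_comp]
  simp only [Fintype.sum_sum_type, Fintype.sum_sigma, Fintype.sum_prod_type, supplyEquiv,
    Supply.node, Supply.label, Equiv.coe_fn_symm_mk, Finset.sum_const, Finset.card_univ,
    Fintype.card_fin, nsmul_eq_mul, hcoe]

theorem sum_demand (g : V → RecvSet G.D → ℚ) :
    ∑ d : G.Demand c, g d.node d.label =
      ((∑ k : G.D, c.rate * g k.1 (G.oneRecv k)) + ∑ e, ∑ P, c.load e P * g (G.src e) P) +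
        ((∑ v, ∑ Q : RecvColl G.D, c.rep v Q * g v Q.union) +
          ∑ v, ∑ Q : RecvColl G.D, c.cod v Q * ∑ P ∈ Q.1, g v P) := by
  have hcoe : ∀ v (Q : RecvColl G.D), ∑ P ∈ Q.1, g v P = ∑ P : {P // P ∈ Q.1}, g v P.1 :=
    fun v Q => (Finset.sum_coe_sort Q.1 (g v)).symm
  rw [← (demandEquiv G c).symm.sum_comp]
  simp only [Fintype.sum_sum_type, Fintype.sum_sigma, Fintype.sum_prod_type, demandEquiv,
    Demand.node, Demand.label, Equiv.coe_fn_symm_mk, Finset.sum_const, Finset.card_univ,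
    Fintype.card_fin, nsmul_eq_mul, hcoe]

theorem sum_indicator_supply_eq_sum_indicator_demand {T : ℕ}
    {X : E → RecvSet G.D → ℚ} {R N : V → RecvColl G.D → ℚ} {h : ℚ}
    (node : G.NodeConstraints X R N h)
    (hrate : (c.rate : ℚ) = T * h) (hload : ∀ e P, (c.load e P : ℚ) = T * X e P)
    (hrep : ∀ v Q, (c.rep v Q : ℚ) = T * R v Q) (hcod : ∀ v Q, (c.cod v Q : ℚ) = T * N v Q)
    (v : V) (P : RecvSet G.D) :
    (∑ s : G.Supply c, if s.node = v ∧ s.label = P then (1 : ℚ) else 0) =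
      ∑ d : G.Demand c, if d.node = v ∧ d.label = P then (1 : ℚ) else 0 := by
  rw [sum_supply (fun v' P' => if v' = v ∧ P' = P then (1 : ℚ) else 0),
    sum_demand (fun v' P' => if v' = v ∧ P' = P then (1 : ℚ) else 0)]
  have hin : ∑ e, ∑ P', (c.load e P' : ℚ) * (if G.tgt e = v ∧ P' = P then 1 else 0) =
      T * G.inFlow X v P := by
    simp [ite_and, hload, inFlow, Finset.mul_sum, Finset.sum_ite]
  have hout : ∑ e, ∑ P', (c.load e P' : ℚ) * (if G.src e = v ∧ P' = P then 1 else 0) =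
      T * G.outFlow X v P := by
    simp [ite_and, hload, outFlow, Finset.mul_sum, Finset.sum_ite]
  have hinj : (c.rate : ℚ) * (if G.source = v ∧ G.allRecv = P then 1 else 0) =
      T * G.injected h v P := by
    simp [hrate, injected, eq_comm]
  have hdel : ∑ k : G.D, (c.rate : ℚ) * (if k.1 = v ∧ G.oneRecv k = P then 1 else 0) =
      T * G.delivered h v P := by
    have : ∀ k : G.D, (k.1 = v ∧ G.oneRecv k = P) ↔ (k.1 = v ∧ P.1 = {v}) := by
      intro k
      refine and_congr_right fun hk => ?_
      rw [Subtype.ext_iff, eq_comm, ← hk]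
      rfl
    simp only [this, hrate, delivered]
    rw [Finset.sum_coe_sort G.D (fun k => (T * h : ℚ) * if k = v ∧ P.1 = {v} then 1 else 0)]
    simp [ite_and]
  have hmem : ∀ n : V → RecvColl G.D → ℚ,
      ∑ v', ∑ Q : RecvColl G.D, n v' Q * ∑ P' ∈ Q.1, (if v' = v ∧ P' = P then (1 : ℚ) else 0) =
        ∑ Q : RecvColl G.D with P ∈ Q.1, n v Q := by
    intro n
    rw [Finset.sum_eq_single v (fun v' _ hv' => by simp [hv']) (by simp)]
    simp [Finset.sum_ite]
  have hunion : ∀ n : V → RecvColl G.D → ℚ,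
      ∑ v', ∑ Q : RecvColl G.D, n v' Q * (if v' = v ∧ Q.union = P then (1 : ℚ) else 0) =
        ∑ Q : RecvColl G.D with Q.union = P, n v Q := by
    intro n
    rw [Finset.sum_eq_single v (fun v' _ hv' => by simp [hv']) (by simp)]
    simp [Finset.sum_ite]
  rw [hin, hout, hinj, hdel, hmem (fun v Q => c.rep v Q), hmem (fun v Q => c.cod v Q),
    hunion (fun v Q => c.rep v Q), hunion (fun v Q => c.cod v Q)]
  have hnode := node v P
  simp only [Finset.sum_sub_distrib] at hnode
  simp only [hrep, hcod, ← Finset.mul_sum]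
  linear_combination -(T : ℚ) * hnode

/-- Uses and available packets have equinumerous fibres over (node, label); bijections of the fibres
glue together. -/
theorem exists_wiring {T : ℕ}
    {X : E → RecvSet G.D → ℚ} {R N : V → RecvColl G.D → ℚ} {h : ℚ}
    (node : G.NodeConstraints X R N h)
    (hrate : (c.rate : ℚ) = T * h) (hload : ∀ e P, (c.load e P : ℚ) = T * X e P)
    (hrep : ∀ v Q, (c.rep v Q : ℚ) = T * R v Q) (hcod : ∀ v Q, (c.cod v Q : ℚ) = T * N v Q) :
    ∃ wire : G.Demand c ≃ G.Supply c,
      ∀ d, (wire d).node = d.node ∧ (wire d).label = d.label := by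
  have hfib : ∀ vP : V × RecvSet G.D,
      Nonempty ({d : G.Demand c // (d.node, d.label) = vP} ≃
        {s : G.Supply c // (s.node, s.label) = vP}) := by
    rintro ⟨v, P⟩
    have := sum_indicator_supply_eq_sum_indicator_demand node hrate hload hrep hcod v P
    rw [Finset.sum_boole, Finset.sum_boole] at this
    refine Fintype.card_eq.1 ?_
    simp only [Fintype.card_subtype, Prod.mk.injEq]
    exact_mod_cast this.symm
  have e := fun vP => (hfib vP).some
  refine ⟨Equiv.ofFiberEquiv e, fun d => ?_⟩
  have := Equiv.ofFiberEquiv_map e d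
  exact Prod.mk.injEq .. ▸ this

end Wiring

end MulticastNetwork

/-! ### The member of a collection that contains a given receiver. -/

namespace RecvColl

variable {V : Type*} [DecidableEq V] {D : Finset V}

/-- The implication makes the choice total: if `k` is outside the union, any member serves. -/
theorem exists_part (k : V) (Q : RecvColl D) :
    ∃ P : {P // P ∈ Q.1}, k ∈ Q.union.1 → k ∈ P.1.1 := by
  by_cases hk : k ∈ Q.union.1
  · obtain ⟨P, hP, hkP⟩ := Finset.mem_biUnion.1 hk
    exact ⟨⟨P, hP⟩, fun _ => hkP⟩
  · obtain ⟨P, hP⟩ := Finset.card_pos.1 (lt_of_lt_of_le Nat.zero_lt_two Q.2.1)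
    exact ⟨⟨P, hP⟩, fun h => absurd h hk⟩

/-- The member of `Q` that contains the receiver `k`, if there is one. -/
noncomputable def part (k : V) (Q : RecvColl D) : {P // P ∈ Q.1} :=
  (exists_part k Q).choose

theorem mem_part {k : V} {Q : RecvColl D} (hk : k ∈ Q.union.1) : k ∈ (part k Q).1.1 :=
  (exists_part k Q).choose_spec hk

theorem mem_union {k : V} {Q : RecvColl D} {P : RecvSet D} (hP : P ∈ Q.1) (hk : k ∈ P.1) :
    k ∈ Q.union.1 :=
  Finset.mem_biUnion.2 ⟨P, hP, hk⟩

theorem eq_of_mem {k : V} {Q : RecvColl D} {P P' : RecvSet D} (hP : P ∈ Q.1)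
    (hP' : P' ∈ Q.1) (hk : k ∈ P.1) (hk' : k ∈ P'.1) : P = P' := by
  by_contra hne
  exact Finset.disjoint_left.1 (Q.2.2 P hP P' hP' hne) hk hk'

end RecvColl

namespace MulticastNetwork

variable {V E : Type*} [DecidableEq V]

/-! ### The code as a linear system, and decoding with delay. -/

section Transfer

variable {G : MulticastNetwork V E} {c : G.Counts}

noncomputable instance : DecidableEq (G.Supply c) := Classical.decEq _

/-- The linear map that takes the symbols of one time unit to those of the next, for coding
coefficients in a commutative ring. -/
noncomputable def stepMatrix {A : Type*} [CommRing A] (wire : G.Demand c ≃ G.Supply c)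
    (coef : (v : V) → (Q : RecvColl G.D) → Fin (c.cod v Q) → RecvSet G.D → A) :
    Matrix (G.Supply c) (G.Supply c) A
  | .inject _, _ => 0
  | .arrive e P i, s => if s = wire (.send e P i) then 1 else 0
  | .copy v Q i _ _, s => if s = wire (.replicate v Q i) then 1 else 0
  | .coded v Q i, s =>
      ∑ P : {P // P ∈ Q.1}, if s = wire (.merge v Q i P.1 P.2) then coef v Q i P.1 else 0

theorem stepMatrix_map {A A' : Type*} [CommRing A] [CommRing A'] (φ : A →+* A')
    (wire : G.Demand c ≃ G.Supply c)
    (coef : (v : V) → (Q : RecvColl G.D) → Fin (c.cod v Q) → RecvSet G.D → A) :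
    (stepMatrix wire coef).map φ = stepMatrix wire fun v Q i P => φ (coef v Q i P) := by
  ext s s'
  cases s <;> simp [stepMatrix, apply_ite φ]

theorem Code.signal_zero {F : Type*} [Field F] (c : G.Code F)
    (w : Fin c.rate → ℕ → F) (s : G.Supply c.toCounts) :
    c.signal w 0 s = ∑ j, (1 : Matrix (G.Supply c.toCounts) (G.Supply c.toCounts) F) s (Supply.inject j) * w j 0 := by
  cases s <;> simp [Code.signal, one_apply]

theorem Code.signal_succ [Fintype V] [Fintype E] {F : Type*} [Field F] (c : G.Code F)
    (w : Fin c.rate → ℕ → F) (t : ℕ) (s : G.Supply c.toCounts) :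
    c.signal w (t + 1) s = ∑ j, (1 : Matrix (G.Supply c.toCounts) (G.Supply c.toCounts) F) s (Supply.inject j) * w j (t + 1) +
      ∑ s', stepMatrix c.wire c.coef s s' * c.signal w t s' := by
  cases s with
  | coded v Q i =>
    simp only [Code.signal, stepMatrix, one_apply, Finset.sum_mul, ite_mul, zero_mul]
    rw [Finset.sum_comm]
    simp
  | _ => simp [Code.signal, stepMatrix, one_apply]

variable [Fintype V] [Fintype E]

/-- Unrolling the linear recurrence `signal_succ` gives a convolution of the source streams with the
powers of the step matrix. -/
theorem Code.signal_eq_sum {F : Type*} [Field F] (c : G.Code F)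
    (w : Fin c.rate → ℕ → F) (t : ℕ) (s : G.Supply c.toCounts) :
    c.signal w t s = ∑ j, ∑ p ∈ Finset.HasAntidiagonal.antidiagonal t,
      (stepMatrix c.wire c.coef ^ p.1) s (Supply.inject j) * w j p.2 := by
  induction t generalizing s with
  | zero => simp [Code.signal_zero]
  | succ t ih =>
    rw [Code.signal_succ]
    simp only [Finset.Nat.antidiagonal_succ, Finset.sum_cons, Finset.sum_map,
      Finset.sum_add_distrib, pow_zero]
    congr 1
    simp only [ih, Embedding.prodMap, Embedding.coeFn_mk, Prod.map, Embedding.refl_apply,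
      Nat.succ_eq_add_one, pow_succ', mul_apply, Finset.sum_mul, Finset.mul_sum]
    rw [Finset.sum_comm]
    refine Finset.sum_congr rfl fun j _ => ?_
    rw [Finset.sum_comm]
    exact Finset.sum_congr rfl fun p _ => Finset.sum_congr rfl fun s' _ => (mul_assoc ..).symm

/-- As power series in time, the outputs are `M` times the source streams, so a left inverse up to
`X ^ δ` recovers them with delay `δ`. -/
theorem Code.canDecode_of_det_ne_zero {F : Type*} [Field F] (c : G.Code F) (k : G.D)
    (hdet : (transferMatrix (stepMatrix c.wire c.coef) Supply.inject
      (fun i => c.wire (.deliver k i))).det ≠ 0) : c.CanDecode k := by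
  set M := transferMatrix (stepMatrix c.wire c.coef) Supply.inject
      (fun i => c.wire (.deliver k i)) with hM
  obtain ⟨δ, L, hL⟩ := M.exists_mul_eq_X_pow_smul_one hdet
  -- The decoder is the coefficient of `X ^ (t + δ)` in `L` times the output series; it needs
  -- outputs up to time `t + δ` only, so the subtraction never truncates.
  refine ⟨δ, fun t y i => ∑ j, ∑ s : Fin (t + δ + 1),
    PowerSeries.coeff (t + δ - s) (L i j) * y j s, fun w t i => ?_⟩
  have hout : ∀ j, PowerSeries.mk (c.output w k j) =
      (M *ᵥ fun j => PowerSeries.mk (w j)) j := by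
    intro j
    ext n
    simp [mulVec, dotProduct, PowerSeries.coeff_mul, hM, transferMatrix, Code.output,
      Code.signal_eq_sum]
  have hdec : ∑ j, L i j * PowerSeries.mk (c.output w k j) =
      PowerSeries.X ^ δ * PowerSeries.mk (w i) := by
    simp only [hout]
    change (L *ᵥ (M *ᵥ fun j => PowerSeries.mk (w j))) i = _
    rw [mulVec_mulVec, hL, smul_mulVec, one_mulVec]
    rfl
  have hcoeff := congrArg (PowerSeries.coeff (t + δ)) hdec
  rw [PowerSeries.coeff_X_pow_mul, PowerSeries.coeff_mk, map_sum] at hcoeff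
  rw [← hcoeff]
  refine Finset.sum_congr rfl fun j _ => ?_
  rw [mul_comm (L i j), PowerSeries.coeff_mul,
    Finset.Nat.sum_antidiagonal_eq_sum_range_succ_mk,
    Finset.sum_range fun s => PowerSeries.coeff s (PowerSeries.mk (c.output w k j)) *
      PowerSeries.coeff (t + δ - s) (L i j)]
  simp [mul_comm]

end Transfer

/-! ### Packet paths backward in time for one receiver. -/

section Paths

variable {G : MulticastNetwork V E} {c : G.Counts}

/-- The use of a packet from which a supply meant for `k` originates; source packets are linked
to the deliveries at `k`. -/
noncomputable def Supply.origin (k : G.D) : G.Supply c → G.Demand c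
  | .inject i => .deliver k i
  | .arrive e P i => .send e P i
  | .copy v Q i _ _ => .replicate v Q i
  | .coded v Q i => .merge v Q i (RecvColl.part k.1 Q).1 (RecvColl.part k.1 Q).2

theorem Supply.mem_label_origin {k : G.D} {s : G.Supply c} (hs : k.1 ∈ s.label.1) :
    k.1 ∈ (s.origin k).label.1 := by
  cases s with
  | inject i => exact Finset.mem_singleton_self _
  | arrive e P i => exact hs
  | copy v Q i P hP => exact RecvColl.mem_union hP hs
  | coded v Q i => exact RecvColl.mem_part hs

/-- Only the copies made by one replication share an origin, and at most one of their disjoint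
labels contains `k`. -/
theorem Supply.origin_injOn (k : G.D) :
    Set.InjOn (Supply.origin (c := c) k) {s | k.1 ∈ s.label.1} := by
  intro s hs s' hs' h
  cases s <;> cases s' <;> simp only [Supply.origin, reduceCtorEq, Demand.deliver.injEq,
    Demand.send.injEq, Demand.replicate.injEq, Demand.merge.injEq] at h
  case inject.inject => rw [h.2]
  case arrive.arrive =>
    obtain ⟨rfl, rfl, h⟩ := h
    rw [eq_of_heq h]
  case copy.copy v Q i P hP v' Q' i' P' hP' =>
    obtain ⟨rfl, rfl, h⟩ := h
    obtain rfl := eq_of_heq h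
    obtain rfl : P = P' := RecvColl.eq_of_mem hP hP' hs hs'
    rfl
  case coded.coded =>
    obtain ⟨rfl, rfl, h, -⟩ := h
    rw [eq_of_heq h]

/-- If every coding operation just forwards its input meant for `k`, then symbols move along
paths. -/
theorem stepMatrix_part_eq_stoppedMatrix (wire : G.Demand c ≃ G.Supply c) (k : G.D) :
    stepMatrix wire (fun _ Q _ P => if P = (RecvColl.part k.1 Q).1 then (1 : ℤ) else 0) =
      stoppedMatrix ℤ (fun s => wire (s.origin k)) Supply.inject := by
  ext s s'
  cases s with
  | coded v Q i =>
    simp only [stepMatrix, stoppedMatrix, Supply.origin, Set.mem_range, reduceCtorEq, exists_false,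
      not_false_eq_true, true_and]
    rw [Finset.sum_eq_single (RecvColl.part k.1 Q)]
    · simp
    · intro P _ hP
      simp [Subtype.ext_iff.not.1 hP]
    · simp
  | _ => simp [stepMatrix, stoppedMatrix, Supply.origin]

theorem exists_coeff_det_transferMatrix_part_isUnit [Fintype V] [Fintype E]
    {wire : G.Demand c ≃ G.Supply c}
    (hlabel : ∀ d, (wire d).label = d.label) (k : G.D) :
    ∃ n, IsUnit (PowerSeries.coeff n (transferMatrix
      (stepMatrix wire (fun _ Q _ P => if P = (RecvColl.part k.1 Q).1 then (1 : ℤ) else 0))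
      Supply.inject (fun i => wire (.deliver k i))).det) := by
  rw [stepMatrix_part_eq_stoppedMatrix]
  -- The delivered packets are `f (inject i)` by definition of `origin`, so the first-return result
  -- applies as it stands.
  refine exists_coeff_det_transferMatrix_isUnit (f := fun s => wire (s.origin k))
    (U := {s | k.1 ∈ s.label.1}) (fun i j h => by injection h) (fun s hs => ?_)
    (fun s hs s' hs' h => Supply.origin_injOn k hs hs' (wire.injective h)) (fun i => k.2)
  change k.1 ∈ (wire (s.origin k)).label.1
  rw [hlabel]
  exact Supply.mem_label_origin hs

end Paths

/-! ### Generic coding coefficients and their specialization. -/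

section Generic

variable [Fintype V] [Fintype E]

variable (G : MulticastNetwork V E) (c : G.Counts)

/-- The index set of the coding coefficients of all coding operations. -/
abbrev CoefIndex : Type _ := (Σ (v : V) (Q : RecvColl G.D), Fin (c.cod v Q)) × RecvSet G.D

variable {G c}

theorem aeval_coeff_det_transferMatrix {A : Type*} [CommRing A] (wire : G.Demand c ≃ G.Supply c)
    (x : CoefIndex G c → A) (out : Fin c.rate → G.Supply c) (n : ℕ) :
    MvPolynomial.aeval x (PowerSeries.coeff n (transferMatrix (stepMatrix wire fun v Q i P =>
        (MvPolynomial.X (⟨v, Q, i⟩, P) : MvPolynomial (CoefIndex G c) ℤ)) Supply.inject out).det) =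
      PowerSeries.coeff n (transferMatrix
        (stepMatrix wire fun v Q i P => x (⟨v, Q, i⟩, P)) Supply.inject out).det := by
  let φ : MvPolynomial (CoefIndex G c) ℤ →+* A := (MvPolynomial.aeval x).toRingHom
  change φ _ = _
  rw [← PowerSeries.coeff_map, RingHom.map_det, RingHom.mapMatrix_apply, transferMatrix_map,
    stepMatrix_map]
  simp [φ]

/-- Coding coefficients can be chosen over every large finite field, for all receivers at once. -/
theorem exists_coef {wire : G.Demand c ≃ G.Supply c}
    (hlabel : ∀ d, (wire d).label = d.label) :
    ∃ q₀ : ℕ, ∀ (F : Type*) [Field F] [Finite F], q₀ ≤ Nat.card F →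
      ∃ coef : (v : V) → (Q : RecvColl G.D) → Fin (c.cod v Q) → RecvSet G.D → F,
        (∀ v Q i P, coef v Q i P ≠ 0) ∧
          ∀ k : G.D, (transferMatrix (stepMatrix wire coef) Supply.inject
            (fun i => wire (.deliver k i))).det ≠ 0 := by
  choose n hn using fun k => exists_coeff_det_transferMatrix_part_isUnit hlabel k
  let p (k : G.D) : MvPolynomial (CoefIndex G c) ℤ :=
    PowerSeries.coeff (n k) (transferMatrix (stepMatrix wire fun v Q i P =>
      MvPolynomial.X (⟨v, Q, i⟩, P)) Supply.inject (fun i => wire (.deliver k i))).det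
  -- The factor of all variables forces every coefficient to be nonzero.
  let q : MvPolynomial (CoefIndex G c) ℤ := (∏ k, p k) * ∏ j, MvPolynomial.X j
  -- The bound comes from an integer polynomial, hence does not depend on the field.
  refine ⟨q.totalDegree + 1, fun F _ _ hF => ?_⟩
  have hp : ∀ k, MvPolynomial.map (Int.castRingHom F) (p k) ≠ 0 := by
    intro k hzero
    -- At this forwarding point `p k` is a unit of `ℤ`, which survives in every characteristic.
    let x : CoefIndex G c → ℤ := fun j => if j.2 = (RecvColl.part k.1 j.1.2.1).1 then 1 else 0
    have hunit : IsUnit (MvPolynomial.aeval x (p k)) := by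
      rw [aeval_coeff_det_transferMatrix]
      exact hn k
    refine (hunit.map (Int.castRingHom F)).ne_zero ?_
    rw [MvPolynomial.aeval_eq_eval, MvPolynomial.map_eval, hzero, map_zero]
  have hq : MvPolynomial.map (Int.castRingHom F) q ≠ 0 := by
    simp only [q, map_mul, map_prod, MvPolynomial.map_X]
    exact mul_ne_zero (Finset.prod_ne_zero_iff.2 fun k _ => hp k)
      (Finset.prod_ne_zero_iff.2 fun j _ => MvPolynomial.X_ne_zero j)
  obtain ⟨x, hx⟩ := MvPolynomial.exists_aeval_ne_zero q hq hF
  simp only [q, map_mul, map_prod, MvPolynomial.aeval_X, mul_ne_zero_iff,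
    Finset.prod_ne_zero_iff, Finset.mem_univ, true_implies] at hx
  refine ⟨fun v Q i P => x (⟨v, Q, i⟩, P), fun v Q i P => hx.2 _, fun k hzero => hx.1 k ?_⟩
  rw [aeval_coeff_det_transferMatrix, hzero, map_zero]

end Generic

end MulticastNetwork

/-! ### Assembly of the code. -/

theorem theorem3 {V E : Type*} [Fintype V] [DecidableEq V] [Fintype E]
    (G : MulticastNetwork V E) (X : E → RecvSet G.D → ℚ) (R N : V → RecvColl G.D → ℚ) (h : ℚ)
    (hh : 0 ≤ h) (hX : ∀ e P, 0 ≤ X e P) (hR : ∀ v Q, 0 ≤ R v Q) (hN : ∀ v Q, 0 ≤ N v Q)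
    (edge : G.EdgeConstraints X) (flow : G.FlowConstraints X h)
    (node : G.NodeConstraints X R N h) :
    (∃ T : ℕ, 0 < T ∧ G.IntegralOver T X R N h) ∧
      ∀ T : ℕ, 0 < T → G.IntegralOver T X R N h →
        ∃ q₀ : ℕ, ∀ (F : Type*) [Field F] [Finite F], q₀ ≤ Nat.card F →
          ∃ c : G.Code F, c.Valid T ∧ c.Performs T X R N h := by
  refine ⟨?_, fun T _ hT => ?_⟩
  · obtain ⟨T, hT, hint⟩ := exists_pos_forall_int_eq_mul
      (Sum.elim (fun _ : Unit => h) (Sum.elim (fun p : E × RecvSet G.D => X p.1 p.2)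
        (Sum.elim (fun p : V × RecvColl G.D => R p.1 p.2)
          (fun p : V × RecvColl G.D => N p.1 p.2))))
    exact ⟨T, hT, hint (.inl ()), fun e P => hint (.inr (.inl (e, P))),
      fun v Q => hint (.inr (.inr (.inl (v, Q)))), fun v Q => hint (.inr (.inr (.inr (v, Q))))⟩
  · have hnat : ∀ q : ℚ, 0 ≤ q → (∃ m : ℤ, (m : ℚ) = T * q) → ∃ m : ℕ, (m : ℚ) = T * q := by
      rintro q hq ⟨m, hm⟩
      have : (0 : ℚ) ≤ m := hm ▸ mul_nonneg T.cast_nonneg hq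
      obtain ⟨l, rfl⟩ := Int.eq_ofNat_of_zero_le (Int.cast_nonneg_iff.1 this)
      exact ⟨l, by exact_mod_cast hm⟩
    obtain ⟨rate, hrate⟩ := hnat h hh hT.1
    choose load hload using fun e P => hnat _ (hX e P) (hT.2.1 e P)
    choose rep hrep using fun v Q => hnat _ (hR v Q) (hT.2.2.1 v Q)
    choose cod hcod using fun v Q => hnat _ (hN v Q) (hT.2.2.2 v Q)
    obtain ⟨wire, hwire⟩ := MulticastNetwork.exists_wiring (c := ⟨rate, load, rep, cod⟩)
      node hrate hload hrep hcod
    obtain ⟨q₀, hq₀⟩ := MulticastNetwork.exists_coef fun d => (hwire d).2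
    refine ⟨q₀, fun F _ _ hF => ?_⟩
    obtain ⟨coef, hne, hdet⟩ := hq₀ F hF
    let c : G.Code F :=
      { rate, load, rep, cod, wire, coef
        node_wire := fun d => (hwire d).1
        label_wire := fun d => (hwire d).2
        coef_ne_zero := fun v Q i P _ => hne v Q i P }
    refine ⟨c, ⟨fun e => ?_, fun k => c.canDecode_of_det_ne_zero k (hdet k)⟩,
      hrate, hload, hrep, hcod⟩
    have hsum : ((∑ P, load e P : ℕ) : ℚ) = T * ∑ P, X e P := by
      push_cast
      rw [Finset.mul_sum]
      exact Finset.sum_congr rfl fun P _ => hload e P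
    have hsum' : ((∑ P, load e P : ℕ) : ℝ) = T * ((∑ P, X e P : ℚ) : ℝ) := by
      exact_mod_cast congrArg (Rat.cast : ℚ → ℝ) hsum
    change ((∑ P, load e P : ℕ) : ℝ) ≤ _
    rw [hsum']
    exact mul_le_mul_of_nonneg_left (edge e) T.cast_nonneg
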